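/- Let $1\le s\le d$ be integers and consider the hypercubic lattice $\mathbb L^d=(\mathbb Z^d,\mathbb E^d)$, where $\mathbb E^d$ is the set of pairs $\{x,y\}\subset\mathbb Z^d$ with $\|x-y\|_1=1$. Let $H=\mathbb Z^s\times\{0\}^{d-s}$. For $p,q\in[0,1]$, let $P_{p,q}$ be the law on $\{0,1\}^{\mathbb E^d}$ under which the edges are open independently of each other, each edge with both endpoints in $H$ being open with probability $q$ and every other edge being open with probability $p$. Let $\{o\leftrightarrow\infty\}$ be the event that the set of vertices joined to the origin by open paths is infinite, and define $q_c\colon[0,1]\to[0,1]$ by $$q_c(p)=\sup\{q\in[0,1] : P_{p,q}(o\leftrightarrow\infty)=0\},$$ with the convention $\sup\emptyset=0$. Then the function $p\mapsto q_c(p)$ is continuous at $p=0$. -/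

import Mathlib

open MeasureTheory ProbabilityTheory unitInterval

namespace DefectPercolation

/-- The hypercubic lattice `𝕃^d`: vertex set `ℤ^d`, with an edge between `x` and `y` exactly when
their `L¹` distance is `1`. -/
def lattice (d : ℕ) : SimpleGraph (Fin d → ℤ) where
  Adj x y := ∑ i, |x i - y i| = 1
  symm := ⟨fun x y h => by simpa only [abs_sub_comm] using h⟩
  loopless := ⟨fun x h => by simp at h⟩

/-- The sublattice of defects `H = ℤ^s × {0}^(d-s)`. -/
def sublattice (d s : ℕ) : Set (Fin d → ℤ) :=
  {x | ∀ i : Fin d, s ≤ (i : ℕ) → x i = 0}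

/-- Percolation configurations on `𝕃^d`: `true` means open and `false` means closed. The
σ-algebra is the product one, generated by the finite-dimensional cylinders. -/
abbrev Config (d : ℕ) : Type := (lattice d).edgeSet → Bool

open scoped Classical in
/-- The opening probability of an edge: `q` if both of its endpoints are in `H`, and `p`
otherwise. -/
noncomputable def edgeProb (d s : ℕ) (p q : I) (e : (lattice d).edgeSet) : I :=
  if ∀ v ∈ (e : Sym2 (Fin d → ℤ)), v ∈ sublattice d s then q else p

/-- The measure `P_{p,q}`: edges are independent, edge `e` is open with probability
`edgeProb d s p q e`. -/
noncomputable def percMeasure (d s : ℕ) (p q : I) : Measure (Config d) :=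
  Measure.infinitePi fun e => bernoulliMeasure true false (edgeProb d s p q e)

/-- The subgraph of `𝕃^d` formed by the open edges of `ω`. -/
def openGraph {d : ℕ} (ω : Config d) : SimpleGraph (Fin d → ℤ) :=
  SimpleGraph.fromEdgeSet {e | ∃ h : e ∈ (lattice d).edgeSet, ω ⟨e, h⟩ = true}

/-- The cluster of `u`: all vertices joined to `u` by an open path (including `u` itself). -/
def cluster {d : ℕ} (ω : Config d) (u : Fin d → ℤ) : Set (Fin d → ℤ) :=
  {v | (openGraph ω).Reachable u v}

/-- The event `{u ↔ ∞}` that the cluster of `u` is infinite. -/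
def percolates {d : ℕ} (u : Fin d → ℤ) : Set (Config d) :=
  {ω | (cluster ω u).Infinite}

/-- The critical parameter function
`q_c(p) = sup {q ∈ [0,1] : P_{p,q}(o ↔ ∞) = 0}` (equal to `0` if the set is empty). -/
noncomputable def criticalParam (d s : ℕ) (p : I) : ℝ :=
  sSup {x : ℝ | ∃ q : I, (q : ℝ) = x ∧ percMeasure d s p q (percolates 0) = 0}

/-- The critical parameter function takes values in `[0,1]`. -/
theorem criticalParam_mem (d s : ℕ) (p : I) : criticalParam d s p ∈ Set.Icc (0 : ℝ) 1 := by
  constructor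
  · apply Real.sSup_nonneg
    rintro x ⟨q, rfl, -⟩
    exact q.2.1
  · apply Real.sSup_le
    · rintro x ⟨q, rfl, -⟩
      exact q.2.2
    · exact zero_le_one

end DefectPercolation

/-!
The proof is the Duminil-Copin–Tassion argument for sharpness. For a finite set `S ∋ o`, the flux
of `S` is the expected number of open edges by which the cluster of `o` in `S` leaves `S`.

If `o` percolates, the exploration of its cluster in `S` ends with an open boundary edge beyond
which there is still an infinite cluster, so `P(o ↔ ∞) ≤ flux * sup_z P(z ↔ ∞)`; a family of sets,
one around each vertex, with fluxes at most `c < 1` therefore rules out percolation. Conversely,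
suppose that at `p = 0` all fluxes are at least `1` for `q` in an interval. Decomposing according to
the set of vertices which are not joined to the complement of a finite set `Λ`, Russo's formula
gives `f' ≥ 1 - f` for the probability `f` that the cluster of `o` leaves `Λ`, and hence a lower
bound on `f` which does not depend on `Λ`.

Thus just below `q_c(0)` some finite set has flux less than `1` at `(0, q)`. Its flux depends on
finitely many edges only, hence is continuous in `p` and remains less than `1` for small `p`.
Translating this set handles the vertices of `H`, while singletons handle all others, whose edges
are open with probability `p`. So `q_c` is lower semicontinuous at `0`. Upper semicontinuity is
monotonicity: closing the edges with parameter `p` shows that `q_c(p) ≤ q_c(0)`.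
-/

namespace DefectPercolation

section ProductMeasure

variable {ι : Type*} {X : ι → Type*} {A B : Set (∀ i, X i)} {S T : Set ι}

lemma dependsOn_mem_of_forall_imp
    (h : ∀ ω ω' : ∀ i, X i, (∀ i ∈ T, ω i = ω' i) → ω ∈ A → ω' ∈ A) : DependsOn (· ∈ A) T :=
  fun ω ω' hω => propext ⟨h ω ω' hω, h ω' ω fun i hi => (hω i hi).symm⟩

lemma dependsOn_mem_inter (hA : DependsOn (· ∈ A) T) (hB : DependsOn (· ∈ B) T) :
    DependsOn (· ∈ A ∩ B) T :=
  dependsOn_mem_of_forall_imp fun _ _ hω h => ⟨(hA hω).mp h.1, (hB hω).mp h.2⟩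

variable [∀ i, MeasurableSpace (X i)]

lemma measurableSet_of_dependsOn_finset [∀ i, Countable (X i)]
    [∀ i, MeasurableSingletonClass (X i)] {F : Finset ι} (hA : DependsOn (· ∈ A) (F : Set ι)) :
    MeasurableSet A := by
  have preimage_image : F.restrict ⁻¹' (F.restrict '' A) = A := by
    refine Set.Subset.antisymm ?_ (Set.subset_preimage_image _ _)
    rintro ω ⟨ω', hω', h⟩
    exact (hA fun i hi => congrFun h ⟨i, hi⟩).mp hω'
  rw [← preimage_image]
  exact (Finset.measurable_restrict F) (Set.to_countable _).measurableSet

lemma measurableSet_iSup_comap_of_dependsOn (hA : DependsOn (· ∈ A) T) (mA : MeasurableSet A) :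
    MeasurableSet[⨆ i ∈ T, MeasurableSpace.comap (fun ω : ∀ i, X i => ω i) inferInstance] A := by
  classical
  rcases A.eq_empty_or_nonempty with rfl | ⟨ω₀, -⟩
  · exact @MeasurableSet.empty _ (_)
  have preimage_piecewise : (fun ω => T.piecewise ω ω₀) ⁻¹' A = A :=
    Set.ext fun ω => iff_of_eq (hA fun i hi => Set.piecewise_eq_of_mem T ω ω₀ hi)
  rw [← preimage_piecewise]
  suffices h : Measurable[⨆ i ∈ T, MeasurableSpace.comap (fun ω : ∀ i, X i => ω i) inferInstance]
    fun ω => T.piecewise ω ω₀ from h mA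
  refine (@measurable_pi_iff _ _ _ (_) _ _).mpr fun i => ?_
  by_cases hi : i ∈ T
  · simp only [Set.piecewise_eq_of_mem T _ _ hi]
    exact (comap_measurable _).mono (le_iSup₂_of_le i hi le_rfl) le_rfl
  · simp only [Set.piecewise_eq_of_notMem T _ _ hi]
    exact @measurable_const _ _ _ (_) _

lemma infinitePi_real_inter_of_disjoint (μ : ∀ i, Measure (X i)) [∀ i, IsProbabilityMeasure (μ i)]
    (hST : Disjoint S T) (hA : DependsOn (· ∈ A) S) (hB : DependsOn (· ∈ B) T)
    (mA : MeasurableSet A) (mB : MeasurableSet B) :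
    (Measure.infinitePi μ).real (A ∩ B) =
      (Measure.infinitePi μ).real A * (Measure.infinitePi μ).real B := by
  have iIndep_eval : iIndepFun (fun i (ω : ∀ i, X i) => ω i) (Measure.infinitePi μ) :=
    iIndepFun_infinitePi (X := fun _ x => x) fun _ => measurable_id
  have indep := indep_iSup_of_disjoint (fun i => (measurable_pi_apply i).comap_le)
    iIndep_eval.iIndep hST
  simp only [measureReal_def, ← ENNReal.toReal_mul]
  exact congrArg _ ((Indep_iff _ _ _).mp indep A B (measurableSet_iSup_comap_of_dependsOn hA mA)
    (measurableSet_iSup_comap_of_dependsOn hB mB))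

end ProductMeasure

section Bernoulli

variable {ι : Type*} {A : Set (ι → Bool)}

/-- Bernoulli product measure: the coordinates are independent, and coordinate `i` is `true` with
probability `r i`. -/
noncomputable def bernoulliPi (r : ι → I) : Measure (ι → Bool) :=
  Measure.infinitePi fun i => bernoulliMeasure true false (r i)

instance (r : ι → I) : IsProbabilityMeasure (bernoulliPi r) := by
  unfold bernoulliPi
  infer_instance

lemma bernoulliPi_real_inter_of_disjoint (r : ι → I) {B : Set (ι → Bool)} {S T : Set ι}
    (hST : Disjoint S T) (hA : DependsOn (· ∈ A) S) (hB : DependsOn (· ∈ B) T)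
    (mA : MeasurableSet A) (mB : MeasurableSet B) :
    (bernoulliPi r).real (A ∩ B) = (bernoulliPi r).real A * (bernoulliPi r).real B :=
  infinitePi_real_inter_of_disjoint _ hST hA hB mA mB

lemma measurableSet_apply_eq (i : ι) (b : Bool) : MeasurableSet {ω : ι → Bool | ω i = b} :=
  measurable_pi_apply (X := fun _ => Bool) i (measurableSet_singleton b)

lemma dependsOn_apply_eq (i : ι) (b : Bool) :
    DependsOn (· ∈ {ω : ι → Bool | ω i = b}) {i} :=
  dependsOn_mem_of_forall_imp fun _ _ hω h => (hω i rfl).symm.trans h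

lemma bernoulliPi_real_apply_true (r : ι → I) (i : ι) :
    (bernoulliPi r).real {ω | ω i = true} = r i := by
  have := map_measureReal_apply (μ := bernoulliPi r) (measurable_pi_apply i)
    (measurableSet_singleton true)
  rw [bernoulliPi, Measure.infinitePi_map_eval] at this
  exact this.symm.trans (by simp)

lemma bernoulliPi_real_apply_false (r : ι → I) (i : ι) :
    (bernoulliPi r).real {ω | ω i = false} = 1 - r i := by
  rw [← bernoulliPi_real_apply_true, ← probReal_compl_eq_one_sub (measurableSet_apply_eq i true)]
  congr 1
  ext ω
  simp

lemma map_comp_bernoulliPi {κ : Type*} (r : κ → I) {f : ι → κ} (hf : Function.Injective f) :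
    (bernoulliPi r).map (· ∘ f) = bernoulliPi (r ∘ f) :=
  Measure.map_infinitePi_infinitePi_of_inj hf

open scoped Classical in
lemma map_piecewise_false_bernoulliPi (r : ι → I) (T : Set ι) :
    (bernoulliPi r).map (fun ω => T.piecewise ω fun _ => false) =
      bernoulliPi (T.piecewise r fun _ => 0) := by
  have h := Measure.infinitePi_map_pi (fun i => bernoulliMeasure true false (r i))
    (f := fun i b => if i ∈ T then b else false) fun _ => measurable_of_finite _
  refine h.trans (congrArg Measure.infinitePi (funext fun i => ?_))
  by_cases hi : i ∈ T <;> simp [hi]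

open scoped Classical in
lemma bernoulliPi_piecewise_zero_le (r : ι → I) (T : Set ι) (mA : MeasurableSet A)
    (hA : IsUpperSet A) : bernoulliPi (T.piecewise r fun _ => 0) A ≤ bernoulliPi r A := by
  have measurable_thin : Measurable fun ω : ι → Bool => T.piecewise ω fun _ => false :=
    measurable_pi_lambda _ fun i => by by_cases hi : i ∈ T <;> simp [hi, measurable_pi_apply]
  rw [← map_piecewise_false_bernoulliPi, Measure.map_apply measurable_thin mA]
  refine measure_mono fun ω hω => hA (Set.piecewise_le (fun _ _ => le_rfl) ?_) hω
  exact fun i _ => Bool.false_le (ω i)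

end Bernoulli

section Russo

variable {ι : Type*} {A : Set (ι → Bool)}

open scoped Classical in
/-- The event that `A` occurs once the coordinate `i` has been given the value `b`. -/
def forceCoord (A : Set (ι → Bool)) (i : ι) (b : Bool) : Set (ι → Bool) :=
  {ω | Function.update ω i b ∈ A}

lemma inter_apply_eq_eq_forceCoord_inter (A : Set (ι → Bool)) (i : ι) (b : Bool) :
    A ∩ {ω | ω i = b} = forceCoord A i b ∩ {ω | ω i = b} := by
  classical
  refine Set.ext fun ω => and_congr_left fun (h : ω i = b) => ?_
  simp only [forceCoord, Set.mem_ofPred_eq, ← h, Function.update_eq_self]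

lemma measurableSet_forceCoord (mA : MeasurableSet A) (i : ι) (b : Bool) :
    MeasurableSet (forceCoord A i b) := by
  classical
  exact measurable_update_left mA

lemma dependsOn_forceCoord {S T : Set ι} (hA : DependsOn (· ∈ A) S) {i : ι} (hST : S ⊆ insert i T)
    (b : Bool) : DependsOn (· ∈ forceCoord A i b) T := by
  classical
  refine dependsOn_mem_of_forall_imp fun ω ω' hω h => (hA fun j hj => ?_).mp h
  rcases eq_or_ne j i with rfl | hji
  · simp only [Function.update_self]
  · simp only [Function.update_of_ne hji]
    exact hω j ((hST hj).resolve_left hji)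

lemma bernoulliPi_real_inter_apply_eq (r : ι → I) (mA : MeasurableSet A) (i : ι) (b : Bool) :
    (bernoulliPi r).real (A ∩ {ω | ω i = b}) =
      (bernoulliPi r).real (forceCoord A i b) * (bernoulliPi r).real {ω | ω i = b} := by
  rw [inter_apply_eq_eq_forceCoord_inter]
  refine bernoulliPi_real_inter_of_disjoint r (disjoint_compl_left (a := {i})) ?_
    (dependsOn_apply_eq i b) (measurableSet_forceCoord mA i b) (measurableSet_apply_eq i b)
  exact dependsOn_forceCoord (dependsOn_univ _) (Set.union_compl_self {i}).ge b

lemma bernoulliPi_real_eq_forceCoord (r : ι → I) (mA : MeasurableSet A) (i : ι) :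
    (bernoulliPi r).real A = r i * (bernoulliPi r).real (forceCoord A i true) +
      (1 - r i) * (bernoulliPi r).real (forceCoord A i false) := by
  have split := measureReal_inter_add_sdiff (μ := bernoulliPi r) (s := A)
    (measurableSet_apply_eq i true)
  have diff_eq : A \ {ω | ω i = true} = A ∩ {ω | ω i = false} := by
    ext ω
    simp
  rw [← split, diff_eq, bernoulliPi_real_inter_apply_eq r mA, bernoulliPi_real_inter_apply_eq r mA,
    bernoulliPi_real_apply_true, bernoulliPi_real_apply_false, mul_comm, mul_comm (_ - _)]

lemma bernoulliPi_real_eq_of_dependsOn_empty (hA : DependsOn (· ∈ A) ∅) (r r' : ι → I) :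
    (bernoulliPi r).real A = (bernoulliPi r').real A := by
  rcases A.eq_empty_or_nonempty with rfl | ⟨ω₀, hω₀⟩
  · simp only [measureReal_empty]
  · rw [Set.eq_univ_of_forall fun ω => (hA.empty ω₀ ω).mp hω₀, probReal_univ, probReal_univ]

lemma continuous_bernoulliPi_real {F : Finset ι} (hA : DependsOn (· ∈ A) (F : Set ι)) :
    Continuous fun r => (bernoulliPi r).real A := by
  classical
  induction F using Finset.induction generalizing A with
  | empty =>
    refine continuous_of_const fun r r' => ?_
    exact bernoulliPi_real_eq_of_dependsOn_empty (by simpa only [Finset.coe_empty] using hA) r r'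
  | insert i F _ ih =>
    simp only [fun r => bernoulliPi_real_eq_forceCoord r (measurableSet_of_dependsOn_finset hA) i]
    have ih' (b : Bool) := ih (dependsOn_forceCoord hA (Finset.coe_insert i F).le b)
    have := ih' true
    have := ih' false
    fun_prop

lemma forceCoord_comm {i j : ι} (hij : i ≠ j) (b c : Bool) :
    forceCoord (forceCoord A i b) j c = forceCoord (forceCoord A j c) i b := by
  classical
  ext ω
  simp only [forceCoord, Set.mem_ofPred_eq, Function.update_comm hij]

lemma hasDerivWithinAt_bernoulliPi_real {r : ℝ → ι → I} {r' : ι → ℝ} {s : Set ℝ} {t : ℝ}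
    (hr : ∀ i, HasDerivWithinAt (fun u => (r u i : ℝ)) (r' i) s t) {F : Finset ι}
    (hA : DependsOn (· ∈ A) (F : Set ι)) :
    HasDerivWithinAt (fun u => (bernoulliPi (r u)).real A)
      (∑ i ∈ F, r' i * ((bernoulliPi (r t)).real (forceCoord A i true) -
        (bernoulliPi (r t)).real (forceCoord A i false))) s t := by
  classical
  induction F using Finset.induction generalizing A with
  | empty =>
    simp only [fun u => bernoulliPi_real_eq_of_dependsOn_empty
      (by simpa only [Finset.coe_empty] using hA) (r u) (r t), Finset.sum_empty]
    exact hasDerivWithinAt_const _ _ _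
  | insert i F hi ih =>
    have mA := measurableSet_of_dependsOn_finset hA
    have ih' (b : Bool) := ih (dependsOn_forceCoord hA (Finset.coe_insert i F).le b)
    have condition (j : ι) (hj : j ∈ F) (b : Bool) : (bernoulliPi (r t)).real (forceCoord A j b) =
        r t i * (bernoulliPi (r t)).real (forceCoord (forceCoord A i true) j b) +
        (1 - r t i) * (bernoulliPi (r t)).real (forceCoord (forceCoord A i false) j b) := by
      have hij : i ≠ j := fun h => hi (h ▸ hj)
      rw [bernoulliPi_real_eq_forceCoord _ (measurableSet_forceCoord mA j b) i,
        forceCoord_comm hij, forceCoord_comm hij]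
    have deriv_condition := ((hr i).mul (ih' true)).add (((hr i).const_sub 1).mul (ih' false))
    simp only [fun u => bernoulliPi_real_eq_forceCoord (r u) mA i]
    refine deriv_condition.congr_deriv ?_
    rw [Finset.sum_insert hi, Finset.mul_sum, Finset.mul_sum, add_add_add_comm,
      ← Finset.sum_add_distrib]
    refine congrArg₂ _ (by ring) (Finset.sum_congr rfl fun j hj => ?_)
    rw [condition j hj true, condition j hj false]
    ring

/-- The event that coordinate `i` is pivotal for `A`. The encoding is meant for increasing events:
it asks that `A` occur when coordinate `i` is `true` and fail when it is `false`. -/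
def pivotal (A : Set (ι → Bool)) (i : ι) : Set (ι → Bool) :=
  forceCoord A i true \ forceCoord A i false

lemma forceCoord_false_subset_forceCoord_true (hA : IsUpperSet A) (i : ι) :
    forceCoord A i false ⊆ forceCoord A i true := by
  classical
  exact fun ω hω => hA (Function.update_mono (Bool.false_le _)) hω

lemma mem_pivotal_of_forall_ge (hA : IsUpperSet A) {i : ι} {ω : ι → Bool} (hω : ω ∉ A)
    (h : ∀ ω', ω ≤ ω' → ω' i = true → ω' ∈ A) : ω ∈ pivotal A i := by
  classical
  refine ⟨h _ (le_update_iff.mpr ⟨Bool.le_true _, fun _ _ => le_rfl⟩)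
    (Function.update_self _ _ _), fun h' => hω (hA ?_ h')⟩
  exact update_le_iff.mpr ⟨Bool.false_le _, fun _ _ => le_rfl⟩

lemma hasDerivWithinAt_bernoulliPi_real_of_isUpperSet {r : ℝ → ι → I} {r' : ι → ℝ} {s : Set ℝ}
    {t : ℝ} (hr : ∀ i, HasDerivWithinAt (fun u => (r u i : ℝ)) (r' i) s t) {F : Finset ι}
    (hA : DependsOn (· ∈ A) (F : Set ι)) (hup : IsUpperSet A) :
    HasDerivWithinAt (fun u => (bernoulliPi (r u)).real A)
      (∑ i ∈ F, r' i * (bernoulliPi (r t)).real (pivotal A i)) s t := by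
  refine (hasDerivWithinAt_bernoulliPi_real hr hA).congr_deriv ?_
  refine Finset.sum_congr rfl fun i _ => ?_
  rw [pivotal, measureReal_sdiff (forceCoord_false_subset_forceCoord_true hup i)
    (measurableSet_forceCoord (measurableSet_of_dependsOn_finset hA) i false)]

end Russo

section Connectivity

variable {V : Type*} {H H' : SimpleGraph V} {x v w : V} {A S : Set V}

lemma mem_of_reachable (hA : ∀ v ∈ A, ∀ w, H.Adj v w → w ∈ A) (hx : x ∈ A)
    (h : H.Reachable x v) : v ∈ A := by
  rw [SimpleGraph.reachable_iff_reflTransGen] at h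
  induction h with
  | refl => exact hx
  | tail _ hvw hv => exact hA _ hv _ hvw

lemma reachable_iff_of_adj_iff
    (h : ∀ v w, H.Reachable x v → (H.Adj v w ↔ H'.Adj v w)) :
    H.Reachable x v ↔ H'.Reachable x v := by
  constructor
  · intro hv
    refine (mem_of_reachable (A := {u | H.Reachable x u ∧ H'.Reachable x u}) ?_
      ⟨.rfl, .rfl⟩ hv).2
    rintro u ⟨hu, hu'⟩ w huw
    exact ⟨hu.trans huw.reachable, hu'.trans ((h u w hu).mp huw).reachable⟩
  · refine mem_of_reachable (A := {u | H.Reachable x u}) (fun u hu w huw => ?_) .rfl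
    exact hu.trans ((h u w hu).mpr huw).reachable

/-- The graph on all of `V` whose edges are the edges of `H` with both endpoints in `S`. -/
def within (H : SimpleGraph V) (S : Set V) : SimpleGraph V where
  Adj v w := H.Adj v w ∧ v ∈ S ∧ w ∈ S
  symm := ⟨fun _ _ h => ⟨h.1.symm, h.2.2, h.2.1⟩⟩
  loopless := ⟨fun _ h => h.1.ne rfl⟩

lemma within_le (H : SimpleGraph V) (S : Set V) : within H S ≤ H := fun _ _ h => h.1

lemma mem_of_reachable_within (hx : x ∈ S) (h : (within H S).Reachable x v) : v ∈ S :=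
  mem_of_reachable (H := within H S) (fun _ _ _ hvw => hvw.2.2) hx h

lemma exists_last_exit (hx : x ∈ S) (h : H.Reachable x v) (hv : v ∉ S) :
    ∃ y ∈ S, ∃ z ∉ S, H.Adj y z ∧ (within H Sᶜ).Reachable z v := by
  refine (mem_of_reachable (A := {v | v ∉ S → ∃ y ∈ S, ∃ z ∉ S, H.Adj y z ∧
    (within H Sᶜ).Reachable z v}) (fun u hu w huw hw => ?_) (fun h => absurd hx h) h) hv
  by_cases huS : u ∈ S
  · exact ⟨u, huS, w, hw, huw, .rfl⟩
  · obtain ⟨y, hy, z, hz, hyz, hzu⟩ := hu huS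
    exact ⟨y, hy, z, hz, hyz, hzu.trans (SimpleGraph.Adj.reachable ⟨huw, huS, hw⟩)⟩

/-- The connected component of `x` in `H` is infinite. -/
def HasInfiniteCluster (H : SimpleGraph V) (x : V) : Prop :=
  {v | H.Reachable x v}.Infinite

lemma HasInfiniteCluster.mono (h : H ≤ H') (hx : HasInfiniteCluster H x) :
    HasInfiniteCluster H' x :=
  Set.Infinite.mono (fun _ hv => SimpleGraph.Reachable.mono h hv) hx

lemma hasInfiniteCluster_iff_forall_finset :
    HasInfiniteCluster H x ↔ ∀ Λ : Finset V, ∃ v ∉ Λ, H.Reachable x v := by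
  constructor
  · intro h Λ
    obtain ⟨v, hv, hvΛ⟩ := h.exists_notMem_finset Λ
    exact ⟨v, hvΛ, hv⟩
  · intro h hfin
    obtain ⟨v, hv, hxv⟩ := h hfin.toFinset
    exact hv (hfin.mem_toFinset.mpr hxv)

lemma HasInfiniteCluster.exists_exit (h : HasInfiniteCluster H x) (hS : S.Finite) (hx : x ∈ S)
    (hH : ∀ y ∈ S, (H.neighborSet y).Finite) :
    ∃ y z, (within H S).Reachable x y ∧ z ∉ S ∧ H.Adj y z ∧
      HasInfiniteCluster (within H {v | (within H S).Reachable x v}ᶜ) z := by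
  set C := {v | (within H S).Reachable x v}
  have C_subset : C ⊆ S := fun v hv => mem_of_reachable_within hx hv
  by_contra! finite_beyond
  have finite_cover : (C ∪ ⋃ y ∈ C, ⋃ z ∈ H.neighborSet y \ S,
      {v | (within H Cᶜ).Reachable z v}).Finite := by
    refine (hS.subset C_subset).union ((hS.subset C_subset).biUnion fun y hy => ?_)
    refine ((hH y (C_subset hy)).subset Set.sdiff_subset).biUnion fun z hz => ?_
    exact Set.not_infinite.mp (finite_beyond y z hy hz.2 hz.1)
  refine h (finite_cover.subset fun v hv => or_iff_not_imp_left.mpr fun hvC => ?_)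
  obtain ⟨y, hy, z, hz, hyz, hzv⟩ := exists_last_exit (S := C) .rfl hv hvC
  have z_notMem : z ∉ S := fun hzS =>
    hz (SimpleGraph.Reachable.trans hy (SimpleGraph.Adj.reachable ⟨hyz, C_subset hy, hzS⟩))
  exact Set.mem_biUnion hy (Set.mem_biUnion (show z ∈ H.neighborSet y \ S from ⟨hyz, z_notMem⟩) hzv)

end Connectivity

section RandomGraph

variable {V Ω : Type*} [Countable V] [MeasurableSpace Ω] {H : Ω → SimpleGraph V}

lemma measurableSet_reachable (hH : ∀ v w, MeasurableSet {ω | (H ω).Adj v w}) (x y : V) :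
    MeasurableSet {ω | (H ω).Reachable x y} := by
  have : Countable ((⊤ : SimpleGraph V).Walk x y) := SimpleGraph.Walk.support_injective.countable
  have iUnion_walk : {ω | (H ω).Reachable x y} =
      ⋃ p : (⊤ : SimpleGraph V).Walk x y, ⋂ e ∈ {e | e ∈ p.edges}, {ω | e ∈ (H ω).edgeSet} := by
    ext ω
    simp only [Set.mem_ofPred_eq, Set.mem_iUnion, Set.mem_iInter]
    constructor
    · rintro ⟨p⟩
      refine ⟨p.mapLe le_top, fun e he => p.edges_subset_edgeSet ?_⟩
      rwa [SimpleGraph.Walk.edges_mapLe_eq_edges] at he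
    · rintro ⟨p, hp⟩
      exact ⟨p.transfer (H ω) hp⟩
  rw [iUnion_walk]
  refine .iUnion fun p => p.edges.finite_toSet.measurableSet_biInter fun e _ => ?_
  induction e with
  | h v w => exact hH v w

lemma measurableSet_hasInfiniteCluster (hH : ∀ v w, MeasurableSet {ω | (H ω).Adj v w}) (x : V) :
    MeasurableSet {ω | HasInfiniteCluster (H ω) x} := by
  have : {ω | HasInfiniteCluster (H ω) x} =
      ⋂ Λ : Finset V, ⋃ v ∈ {v | v ∉ Λ}, {ω | (H ω).Reachable x v} := by
    ext ω
    simp [hasInfiniteCluster_iff_forall_finset]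
  rw [this]
  exact .iInter fun Λ => .biUnion (Set.to_countable _) fun v _ => measurableSet_reachable hH x v

end RandomGraph

section Percolation

variable {V : Type*} {G : SimpleGraph V} {ω ω' : G.edgeSet → Bool} {S : Set V} {y z : V}

/-- The subgraph of `G` formed by the open edges of the configuration `ω`. -/
def openSubgraph (ω : G.edgeSet → Bool) : SimpleGraph V :=
  SimpleGraph.fromEdgeSet {e | ∃ h : e ∈ G.edgeSet, ω ⟨e, h⟩ = true}

lemma openSubgraph_adj :
    (openSubgraph ω).Adj y z ↔ ∃ h : G.Adj y z, ω ⟨s(y, z), h⟩ = true := by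
  simp only [openSubgraph, SimpleGraph.fromEdgeSet_adj]
  exact ⟨fun h => h.1, fun h => ⟨h, h.1.ne⟩⟩

lemma openSubgraph_le (ω : G.edgeSet → Bool) : openSubgraph ω ≤ G :=
  fun _ _ h => (openSubgraph_adj.mp h).1

lemma openSubgraph_mono (h : ω ≤ ω') : openSubgraph ω ≤ openSubgraph ω' := by
  intro y z hyz
  obtain ⟨hG, hω⟩ := openSubgraph_adj.mp hyz
  exact openSubgraph_adj.mpr ⟨hG, Bool.eq_true_of_true_le (hω ▸ h _)⟩

lemma openSubgraph_adj_congr (h : ∀ e : G.edgeSet, (e : Sym2 V) = s(y, z) → ω e = ω' e) :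
    (openSubgraph ω).Adj y z ↔ (openSubgraph ω').Adj y z := by
  simp only [openSubgraph_adj]
  exact exists_congr fun hyz => by rw [h _ rfl]

lemma measurableSet_openSubgraph_adj (y z : V) :
    MeasurableSet {ω : G.edgeSet → Bool | (openSubgraph ω).Adj y z} := by
  simp only [openSubgraph_adj]
  by_cases h : G.Adj y z
  · simpa only [h, exists_true_left] using measurableSet_apply_eq (⟨s(y, z), h⟩ : G.edgeSet) true
  · simp only [h, IsEmpty.exists_iff, Set.ofPred_false, MeasurableSet.empty]

lemma measurableSet_within_openSubgraph_adj (S : Set V) (y z : V) :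
    MeasurableSet {ω : G.edgeSet → Bool | (within (openSubgraph ω) S).Adj y z} :=
  (measurableSet_openSubgraph_adj y z).inter (MeasurableSet.const _)

/-- The edges of `G` with both endpoints in `S`. -/
def edgesIn (G : SimpleGraph V) (S : Set V) : Set G.edgeSet :=
  {e | ∀ v ∈ (e : Sym2 V), v ∈ S}

/-- The edges of `G` with at least one endpoint in `S`. -/
def edgesAt (G : SimpleGraph V) (S : Set V) : Set G.edgeSet :=
  {e | ∃ v ∈ (e : Sym2 V), v ∈ S}

lemma disjoint_edgesAt_edgesIn_compl (G : SimpleGraph V) (S : Set V) :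
    Disjoint (edgesAt G S) (edgesIn G Sᶜ) :=
  Set.disjoint_left.mpr fun _ ⟨v, hv, hvS⟩ h => h v hv hvS

lemma edgesIn_subset_edgesAt (G : SimpleGraph V) (S : Set V) : edgesIn G S ⊆ edgesAt G S :=
  fun e he => ⟨(e : Sym2 V).out.1, Sym2.out_fst_mem _, he _ (Sym2.out_fst_mem _)⟩

lemma finite_edgesAt (G : SimpleGraph V) [G.LocallyFinite] (hS : S.Finite) :
    (edgesAt G S).Finite := by
  classical
  refine ((hS.biUnion fun v _ => (G.incidenceSet v).toFinite).preimage
    Subtype.val_injective.injOn).subset ?_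
  rintro e ⟨v, hv, hvS⟩
  exact Set.mem_biUnion hvS ⟨e.2, hv⟩

lemma dependsOn_within_openSubgraph (P : SimpleGraph V → Prop) (S : Set V) :
    DependsOn (· ∈ {ω : G.edgeSet → Bool | P (within (openSubgraph ω) S)}) (edgesIn G S) := by
  refine dependsOn_mem_of_forall_imp fun ω ω' h hω => ?_
  have within_eq : within (openSubgraph ω) S = within (openSubgraph ω') S := by
    ext y z
    refine and_congr_left fun ⟨hy, hz⟩ => openSubgraph_adj_congr fun e he => h e fun v hv => ?_
    rw [he, Sym2.mem_iff] at hv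
    rcases hv with rfl | rfl <;> assumption
  simpa only [Set.mem_ofPred_eq, ← within_eq] using hω

end Percolation

section Boundary

variable {V : Type*} {G : SimpleGraph V}

/-- The undirected edge underlying a dart, as an element of the edge set. -/
def edgeOfDart (d : G.Dart) : G.edgeSet := ⟨d.edge, d.edge_mem⟩

lemma edgeOfDart_mem_edgesAt {d : G.Dart} {C : Set V} (hd : d.fst ∈ C) :
    edgeOfDart d ∈ edgesAt G C :=
  ⟨d.fst, Sym2.mem_mk_left _ _, hd⟩

variable [G.LocallyFinite] {S : Finset V} {x : V}

open scoped Classical in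
/-- The edge boundary of the finite set `S`, its edges being oriented from `S` to the outside. -/
noncomputable def outDarts (G : SimpleGraph V) [G.LocallyFinite] (S : Finset V) : Finset G.Dart :=
  (S.biUnion fun v => Finset.univ.image (G.dartOfNeighborSet v)).filter fun d => d.snd ∉ S

lemma mem_outDarts {d : G.Dart} : d ∈ outDarts G S ↔ d.fst ∈ S ∧ d.snd ∉ S := by
  simp only [outDarts, Finset.mem_filter, Finset.mem_biUnion, Finset.mem_image, Finset.mem_univ,
    true_and, and_congr_left_iff]
  refine fun _ => ⟨?_, fun h => ⟨d.fst, h, ⟨d.snd, d.adj⟩, rfl⟩⟩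
  rintro ⟨v, hv, w, rfl⟩
  exact hv

lemma card_outDarts_singleton_le (x : V) : (outDarts G {x}).card ≤ G.degree x := by
  classical
  refine (Finset.card_filter_le _ _).trans ?_
  rw [Finset.singleton_biUnion, ← G.card_neighborSet_eq_degree x]
  exact Finset.card_image_le

lemma edgeOfDart_injOn_outDarts : Set.InjOn edgeOfDart (outDarts G S : Set G.Dart) := by
  intro d hd d' hd' h
  rcases (SimpleGraph.dart_edge_eq_iff d d').mp (congrArg Subtype.val h) with rfl | rfl
  · rfl
  · exact absurd (mem_outDarts.mp hd).1 (mem_outDarts.mp hd').2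

lemma edgeOfDart_notMem_edgesIn {d : G.Dart} (hd : d ∈ outDarts G S) :
    edgeOfDart d ∉ edgesIn G S :=
  fun h => (mem_outDarts.mp hd).2 (h d.snd (Sym2.mem_mk_right _ _))

/-- The expected number of edges of the boundary of `S` whose inner endpoint is joined to `x` by an
open path in `S`, an edge `e` being counted with weight `w e`. -/
noncomputable def boundaryFlux (r : G.edgeSet → I) (w : G.edgeSet → ℝ) (x : V) (S : Finset V) : ℝ :=
  ∑ d ∈ outDarts G S, w (edgeOfDart d) *
    (bernoulliPi r).real {ω | (within (openSubgraph ω) S).Reachable x d.fst}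

lemma boundaryFlux_mono (r : G.edgeSet → I) {w w' : G.edgeSet → ℝ} (h : w ≤ w') (x : V)
    (S : Finset V) : boundaryFlux r w x S ≤ boundaryFlux r w' x S :=
  Finset.sum_le_sum fun _ _ => mul_le_mul_of_nonneg_right (h _) measureReal_nonneg

lemma continuous_boundaryFlux (x : V) (S : Finset V) :
    Continuous fun r : G.edgeSet → I => boundaryFlux r (fun e => r e) x S := by
  have edgesIn_finite := (finite_edgesAt G S.finite_toSet).subset (edgesIn_subset_edgesAt G S)
  refine continuous_finsetSum _ fun d _ => .mul (by fun_prop) ?_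
  refine continuous_bernoulliPi_real (F := edgesIn_finite.toFinset) ?_
  rw [Set.Finite.coe_toFinset]
  exact dependsOn_within_openSubgraph (fun H => H.Reachable x d.fst) S

lemma boundaryFlux_singleton_le {r : G.edgeSet → I} {w : G.edgeSet → ℝ} {c : ℝ} (hc : 0 ≤ c)
    (hw : ∀ e : G.edgeSet, x ∈ (e : Sym2 V) → w e ≤ c) :
    boundaryFlux r w x {x} ≤ G.degree x * c := by
  calc boundaryFlux r w x {x} ≤ ∑ _d ∈ outDarts G {x}, c := by
        refine Finset.sum_le_sum fun d hd => ?_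
        have fst_eq : d.fst = x := Finset.mem_singleton.mp (mem_outDarts.mp hd).1
        refine (mul_le_mul_of_nonneg_right (hw (edgeOfDart d) ?_) measureReal_nonneg).trans
          (mul_le_of_le_one_right hc measureReal_le_one)
        exact fst_eq ▸ Sym2.mem_mk_left _ _
    _ ≤ G.degree x * c := by
        rw [Finset.sum_const, nsmul_eq_mul]
        gcongr
        exact card_outDarts_singleton_le x

end Boundary

section Subcritical

variable {V : Type*} {G : SimpleGraph V} {ω : G.edgeSet → Bool} {S C : Finset V} {x : V}

/-- The event that `x` lies in an infinite open cluster. -/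
def percolatesFrom (G : SimpleGraph V) (x : V) : Set (G.edgeSet → Bool) :=
  {ω | HasInfiniteCluster (openSubgraph ω) x}

lemma isUpperSet_percolatesFrom (G : SimpleGraph V) (x : V) : IsUpperSet (percolatesFrom G x) :=
  fun _ _ h hω => hω.mono (openSubgraph_mono h)

lemma measurableSet_percolatesFrom [Countable V] (G : SimpleGraph V) (x : V) :
    MeasurableSet (percolatesFrom G x) :=
  measurableSet_hasInfiniteCluster measurableSet_openSubgraph_adj x

open scoped Classical in
/-- The cluster of `x` formed by the open edges inside the finite set `S`. -/
noncomputable def clusterIn (S : Finset V) (x : V) (ω : G.edgeSet → Bool) : Finset V :=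
  S.filter fun v => (within (openSubgraph ω) S).Reachable x v

lemma mem_clusterIn (hx : x ∈ S) {v : V} :
    v ∈ clusterIn S x ω ↔ (within (openSubgraph ω) S).Reachable x v := by
  simp only [clusterIn, Finset.mem_filter]
  exact and_iff_right_of_imp (mem_of_reachable_within (Finset.mem_coe.mpr hx))

lemma measurableSet_preimage_clusterIn [Countable V] (hx : x ∈ S) (C : Finset V) :
    MeasurableSet (clusterIn (G := G) S x ⁻¹' {C}) := by
  have : clusterIn (G := G) S x ⁻¹' {C} =
      ⋂ v, {ω | (within (openSubgraph ω) S).Reachable x v ↔ v ∈ C} := by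
    ext ω
    simp only [Set.mem_preimage, Set.mem_singleton_iff, Finset.ext_iff, mem_clusterIn hx,
      Set.mem_iInter, Set.mem_ofPred_eq]
  rw [this]
  exact .iInter fun v => (measurableSet_reachable
    (measurableSet_within_openSubgraph_adj _) x v).iff (MeasurableSet.const _)

lemma dependsOn_preimage_clusterIn_edgesIn (x : V) (S C : Finset V) :
    DependsOn (· ∈ clusterIn (G := G) S x ⁻¹' {C}) (edgesIn G S) := by
  simpa only [Set.mem_preimage, Set.mem_singleton_iff, clusterIn, Finset.ext_iff,
    Finset.mem_filter, Set.mem_ofPred_eq] using dependsOn_within_openSubgraph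
      (fun H => ∀ v, v ∈ S ∧ H.Reachable x v ↔ v ∈ C) (S : Set V)

lemma dependsOn_preimage_clusterIn_edgesAt (hx : x ∈ S) (C : Finset V) :
    DependsOn (· ∈ clusterIn (G := G) S x ⁻¹' {C}) (edgesAt G C) := by
  refine dependsOn_mem_of_forall_imp fun ω ω' h hω => ?_
  have cluster_eq : clusterIn S x ω = C := hω
  refine (Finset.ext fun v => ?_).trans cluster_eq
  rw [mem_clusterIn hx, mem_clusterIn hx]
  refine (reachable_iff_of_adj_iff fun u w hu => ?_).symm
  refine and_congr_left fun _ => openSubgraph_adj_congr fun e he => h e ⟨u, ?_, ?_⟩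
  · exact he ▸ Sym2.mem_mk_left u w
  · rwa [Finset.mem_coe, ← cluster_eq, mem_clusterIn hx]

lemma sum_real_preimage_clusterIn [Countable V] (r : G.edgeSet → I) (hx : x ∈ S) {v : V}
    (hv : v ∈ S) [DecidablePred fun C : Finset V => v ∈ C] :
    ∑ C ∈ S.powerset.filter (v ∈ ·), (bernoulliPi r).real (clusterIn S x ⁻¹' {C}) =
      (bernoulliPi r).real {ω | (within (openSubgraph ω) S).Reachable x v} := by
  rw [sum_measureReal_preimage_singleton _ fun C _ => measurableSet_preimage_clusterIn hx C]
  congr 1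
  ext ω
  simp [clusterIn, hv]

/-- The event that the dart `d` is open, starts in the cluster of `x` in `S`, and leads to an
infinite cluster which avoids the cluster of `x` in `S`. -/
def escapesThrough (S : Finset V) (x : V) (d : G.Dart) : Set (G.edgeSet → Bool) :=
  {ω | d.fst ∈ clusterIn S x ω ∧ ω (edgeOfDart d) = true ∧
    HasInfiniteCluster (within (openSubgraph ω) (clusterIn S x ω : Set V)ᶜ) d.snd}

lemma percolatesFrom_subset_iUnion_escapesThrough [G.LocallyFinite] (hx : x ∈ S) :
    percolatesFrom G x ⊆ ⋃ d ∈ outDarts G S, escapesThrough S x d := by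
  intro ω hω
  have coe_clusterIn : {v | (within (openSubgraph ω) S).Reachable x v} = clusterIn S x ω :=
    Set.ext fun v => (mem_clusterIn hx).symm
  obtain ⟨y, z, hy, hz, hyz, hperc⟩ := HasInfiniteCluster.exists_exit hω S.finite_toSet
    (Finset.mem_coe.mpr hx) fun y _ =>
      (G.neighborSet y).toFinite.subset fun _ => (openSubgraph_le ω ·)
  obtain ⟨hG, hopen⟩ := openSubgraph_adj.mp hyz
  rw [coe_clusterIn] at hperc
  refine Set.mem_biUnion (x := ⟨(y, z), hG⟩)
    (mem_outDarts.mpr ⟨mem_of_reachable_within (Finset.mem_coe.mpr hx) hy, hz⟩) ?_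
  exact ⟨(mem_clusterIn hx).mpr hy, hopen, hperc⟩

lemma real_preimage_clusterIn_inter_escapesThrough_le [Countable V] [G.LocallyFinite]
    {r : G.edgeSet → I} {θ : ℝ} (hθ : ∀ z, (bernoulliPi r).real (percolatesFrom G z) ≤ θ)
    (hx : x ∈ S) {d : G.Dart} (hd : d ∈ outDarts G S) (hdC : d.fst ∈ C) :
    (bernoulliPi r).real (clusterIn S x ⁻¹' {C} ∩ escapesThrough S x d) ≤
      r (edgeOfDart d) * (bernoulliPi r).real (clusterIn S x ⁻¹' {C}) * θ := by
  set isOpen : Set (G.edgeSet → Bool) := {ω | ω (edgeOfDart d) = true}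
  set percBeyond : Set (G.edgeSet → Bool) :=
    {ω | HasInfiniteCluster (within (openSubgraph ω) (C : Set V)ᶜ) d.snd}
  have mC := measurableSet_preimage_clusterIn (G := G) hx C
  have mOpen : MeasurableSet isOpen := measurableSet_apply_eq _ _
  have inter_open : (bernoulliPi r).real (clusterIn S x ⁻¹' {C} ∩ isOpen) =
      r (edgeOfDart d) * (bernoulliPi r).real (clusterIn S x ⁻¹' {C}) := by
    rw [bernoulliPi_real_inter_of_disjoint r
      (Set.disjoint_singleton_right.mpr (edgeOfDart_notMem_edgesIn hd))
      (dependsOn_preimage_clusterIn_edgesIn x S C) (dependsOn_apply_eq _ _) mC mOpen,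
      bernoulliPi_real_apply_true, mul_comm]
  have inter_percBeyond :
      (bernoulliPi r).real (clusterIn S x ⁻¹' {C} ∩ isOpen ∩ percBeyond) =
        (bernoulliPi r).real (clusterIn S x ⁻¹' {C} ∩ isOpen) *
          (bernoulliPi r).real percBeyond := by
    refine bernoulliPi_real_inter_of_disjoint r (disjoint_edgesAt_edgesIn_compl G C)
      (dependsOn_mem_inter (dependsOn_preimage_clusterIn_edgesAt hx C) ?_)
      (dependsOn_within_openSubgraph (HasInfiniteCluster · d.snd) _) (mC.inter mOpen)
      (measurableSet_hasInfiniteCluster (measurableSet_within_openSubgraph_adj _) _)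
    exact (dependsOn_apply_eq _ _).mono (Set.singleton_subset_iff.mpr (edgeOfDart_mem_edgesAt hdC))
  have percBeyond_le : (bernoulliPi r).real percBeyond ≤ θ :=
    (measureReal_mono fun ω hω => HasInfiniteCluster.mono (within_le _ _) hω).trans (hθ d.snd)
  calc (bernoulliPi r).real (clusterIn S x ⁻¹' {C} ∩ escapesThrough S x d)
      ≤ (bernoulliPi r).real (clusterIn S x ⁻¹' {C} ∩ isOpen ∩ percBeyond) := by
        refine measureReal_mono ?_
        rintro ω ⟨rfl, -, hopen, hperc⟩
        exact ⟨⟨rfl, hopen⟩, hperc⟩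
    _ ≤ r (edgeOfDart d) * (bernoulliPi r).real (clusterIn S x ⁻¹' {C}) * θ := by
        rw [inter_percBeyond, inter_open]
        exact mul_le_mul_of_nonneg_left percBeyond_le (mul_nonneg (r _).2.1 measureReal_nonneg)

lemma real_escapesThrough_le [Countable V] [G.LocallyFinite] {r : G.edgeSet → I} {θ : ℝ}
    (hθ : ∀ z, (bernoulliPi r).real (percolatesFrom G z) ≤ θ) (hx : x ∈ S) {d : G.Dart}
    (hd : d ∈ outDarts G S) :
    (bernoulliPi r).real (escapesThrough S x d) ≤ r (edgeOfDart d) *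
      (bernoulliPi r).real {ω | (within (openSubgraph ω) S).Reachable x d.fst} * θ := by
  classical
  have subset_iUnion : escapesThrough S x d ⊆ ⋃ C ∈ S.powerset.filter (d.fst ∈ ·),
      clusterIn S x ⁻¹' {C} ∩ escapesThrough S x d := fun ω hω =>
    Set.mem_biUnion (x := clusterIn S x ω) (Finset.mem_filter.mpr
      ⟨Finset.mem_powerset.mpr (Finset.filter_subset _ _), hω.1⟩) ⟨rfl, hω⟩
  calc (bernoulliPi r).real (escapesThrough S x d)
      ≤ ∑ C ∈ S.powerset.filter (d.fst ∈ ·),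
          (bernoulliPi r).real (clusterIn S x ⁻¹' {C} ∩ escapesThrough S x d) :=
        (measureReal_mono subset_iUnion (measure_ne_top _ _)).trans
          (measureReal_biUnion_finset_le _ _)
    _ ≤ ∑ C ∈ S.powerset.filter (d.fst ∈ ·),
          r (edgeOfDart d) * (bernoulliPi r).real (clusterIn S x ⁻¹' {C}) * θ :=
        Finset.sum_le_sum fun C hC =>
          real_preimage_clusterIn_inter_escapesThrough_le hθ hx hd (Finset.mem_filter.mp hC).2
    _ = _ := by
        rw [← Finset.sum_mul, ← Finset.mul_sum,
          sum_real_preimage_clusterIn r hx (mem_outDarts.mp hd).1]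

lemma real_percolatesFrom_le_boundaryFlux_mul [Countable V] [G.LocallyFinite]
    {r : G.edgeSet → I} {θ : ℝ} (hθ : ∀ z, (bernoulliPi r).real (percolatesFrom G z) ≤ θ)
    (hx : x ∈ S) :
    (bernoulliPi r).real (percolatesFrom G x) ≤ boundaryFlux r (fun e => r e) x S * θ :=
  calc (bernoulliPi r).real (percolatesFrom G x)
      ≤ ∑ d ∈ outDarts G S, (bernoulliPi r).real (escapesThrough S x d) :=
        (measureReal_mono (percolatesFrom_subset_iUnion_escapesThrough hx)
          (measure_ne_top _ _)).trans (measureReal_biUnion_finset_le _ _)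
    _ ≤ boundaryFlux r (fun e => r e) x S * θ := by
        rw [boundaryFlux, Finset.sum_mul]
        exact Finset.sum_le_sum fun d hd => real_escapesThrough_le hθ hx hd

lemma eq_zero_of_forall_le_mul {ι : Type*} {f : ι → ℝ} (h0 : ∀ i, 0 ≤ f i)
    (hbdd : BddAbove (Set.range f)) {c : ℝ} (hc : c < 1)
    (h : ∀ θ, (∀ i, f i ≤ θ) → ∀ i, f i ≤ c * θ) (i : ι) : f i = 0 := by
  have le_iSup := le_ciSup hbdd
  have : Nonempty ι := ⟨i⟩
  have iSup_le : ⨆ i, f i ≤ c * ⨆ i, f i := ciSup_le (h _ le_iSup)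
  have iSup_nonpos : ⨆ i, f i ≤ 0 := by nlinarith
  exact le_antisymm ((le_iSup i).trans iSup_nonpos) (h0 i)

lemma bernoulliPi_percolatesFrom_eq_zero {r : G.edgeSet → I} {c : ℝ} (hc : c < 1)
    (h : ∀ θ, (∀ z, (bernoulliPi r).real (percolatesFrom G z) ≤ θ) →
      ∀ z, (bernoulliPi r).real (percolatesFrom G z) ≤ c * θ) (x : V) :
    bernoulliPi r (percolatesFrom G x) = 0 := by
  refine (measureReal_eq_zero_iff).mp (eq_zero_of_forall_le_mul (fun _ => measureReal_nonneg)
    ⟨1, ?_⟩ hc h x)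
  rintro _ ⟨z, rfl⟩
  exact measureReal_le_one

end Subcritical

section Automorphism

variable {V : Type*} {G : SimpleGraph V}

lemma openSubgraph_comp_mapEdgeSet_adj (φ : G ≃g G) (ω : G.edgeSet → Bool) (y z : V) :
    (openSubgraph ω).Adj (φ y) (φ z) ↔ (openSubgraph (ω ∘ φ.mapEdgeSet)).Adj y z := by
  simp only [openSubgraph_adj]
  exact ⟨fun ⟨h, h'⟩ => ⟨φ.map_adj_iff.mp h, h'⟩, fun ⟨h, h'⟩ => ⟨φ.map_adj_iff.mpr h, h'⟩⟩

lemma hasInfiniteCluster_iso_iff {W : Type*} {H : SimpleGraph V} {K : SimpleGraph W} (φ : H ≃g K)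
    (x : V) : HasInfiniteCluster K (φ x) ↔ HasInfiniteCluster H x := by
  have image_cluster : {w | K.Reachable (φ x) w} = φ '' {v | H.Reachable x v} := by
    ext w
    obtain ⟨v, rfl⟩ := φ.surjective w
    simp [φ.injective.eq_iff, SimpleGraph.Iso.reachable_iff]
  rw [HasInfiniteCluster, image_cluster, Set.infinite_image_iff φ.injective.injOn,
    HasInfiniteCluster]

lemma preimage_comp_mapEdgeSet_percolatesFrom (φ : G ≃g G) (x : V) :
    (· ∘ φ.mapEdgeSet) ⁻¹' percolatesFrom G x = percolatesFrom G (φ x) := by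
  refine Set.ext fun ω => (hasInfiniteCluster_iso_iff (K := openSubgraph ω) ⟨φ.toEquiv, ?_⟩ x).symm
  exact openSubgraph_comp_mapEdgeSet_adj φ ω _ _

lemma bernoulliPi_real_percolatesFrom_apply [Countable V] (r : G.edgeSet → I) (φ : G ≃g G)
    (hφ : ∀ e, r (φ.mapEdgeSet e) = r e) (x : V) :
    (bernoulliPi r).real (percolatesFrom G (φ x)) = (bernoulliPi r).real (percolatesFrom G x) := by
  have measurable_comp : Measurable fun ω : G.edgeSet → Bool => ω ∘ φ.mapEdgeSet :=
    measurable_pi_lambda _ fun _ => measurable_pi_apply _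
  rw [← preimage_comp_mapEdgeSet_percolatesFrom,
    ← map_measureReal_apply measurable_comp (measurableSet_percolatesFrom G x),
    map_comp_bernoulliPi r φ.mapEdgeSet.injective]
  exact congrArg (fun r => (bernoulliPi r).real _) (funext hφ)

end Automorphism

section Supercritical

variable {V : Type*} {G : SimpleGraph V} {ω : G.edgeSet → Bool} {Λ S : Finset V} {x y : V}

/-- The event that the open cluster of `x` is not contained in the finite set `Λ`. -/
def exits (Λ : Finset V) (x : V) : Set (G.edgeSet → Bool) :=
  {ω | ∃ v ∉ Λ, (openSubgraph ω).Reachable x v}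

lemma isUpperSet_exits (Λ : Finset V) (x : V) : IsUpperSet (exits (G := G) Λ x) :=
  fun _ _ h ⟨v, hv, hxv⟩ => ⟨v, hv, hxv.mono (openSubgraph_mono h)⟩

lemma mem_exits_of_reachable (h : (openSubgraph ω).Reachable x y) (hy : ω ∈ exits Λ y) :
    ω ∈ exits Λ x :=
  let ⟨v, hv, hyv⟩ := hy
  ⟨v, hv, h.trans hyv⟩

lemma exits_antitone (x : V) : Antitone fun Λ => exits (G := G) Λ x :=
  fun _ _ h _ ⟨v, hv, hxv⟩ => ⟨v, fun hv' => hv (h hv'), hxv⟩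

lemma measurableSet_exits [Countable V] (Λ : Finset V) (x : V) :
    MeasurableSet (exits (G := G) Λ x) := by
  have : exits (G := G) Λ x = ⋃ v ∈ {v | v ∉ Λ}, {ω | (openSubgraph ω).Reachable x v} := by
    ext ω
    simp [exits]
  rw [this]
  exact .biUnion (Set.to_countable _) fun v _ =>
    measurableSet_reachable measurableSet_openSubgraph_adj x v

lemma percolatesFrom_eq_iInter_exits (x : V) : percolatesFrom G x = ⋂ Λ, exits Λ x := by
  refine Set.ext fun ω => ?_
  rw [Set.mem_iInter]
  exact hasInfiniteCluster_iff_forall_finset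

lemma dependsOn_exits (Λ : Finset V) (x : V) :
    DependsOn (· ∈ exits (G := G) Λ x) (edgesAt G Λ) := by
  refine dependsOn_mem_of_forall_imp fun ω ω' h ⟨v, hv, hxv⟩ => by_contra fun hω' => ?_
  refine hω' ⟨v, hv, (reachable_iff_of_adj_iff fun u w hu => ?_).mpr hxv⟩
  have hu_mem : u ∈ Λ := by_contra fun hu' => hω' ⟨u, hu', hu⟩
  refine openSubgraph_adj_congr fun e he => (h e ⟨u, ?_, hu_mem⟩).symm
  exact he ▸ Sym2.mem_mk_left u w

open scoped Classical in
/-- The set of vertices whose open cluster is contained in the finite set `Λ`. -/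
noncomputable def confinedVerts (Λ : Finset V) (ω : G.edgeSet → Bool) : Finset V :=
  Λ.filter fun v => ω ∉ exits Λ v

lemma mem_confinedVerts : x ∈ confinedVerts Λ ω ↔ ω ∉ exits Λ x := by
  simp only [confinedVerts, Finset.mem_filter]
  exact and_iff_right_of_imp fun hω => by_contra fun hx => hω ⟨x, hx, .rfl⟩

lemma confinedVerts_subset : confinedVerts Λ ω ⊆ Λ := by
  classical
  exact Finset.filter_subset _ _

lemma mem_confinedVerts_of_reachable (h : (openSubgraph ω).Reachable x y)
    (hx : x ∈ confinedVerts Λ ω) : y ∈ confinedVerts Λ ω :=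
  mem_confinedVerts.mpr fun hy => mem_confinedVerts.mp hx (mem_exits_of_reachable h hy)

lemma measurableSet_preimage_confinedVerts [Countable V] (Λ S : Finset V) :
    MeasurableSet (confinedVerts (G := G) Λ ⁻¹' {S}) := by
  have : confinedVerts (G := G) Λ ⁻¹' {S} = ⋂ v, {ω | ω ∈ (exits Λ v)ᶜ ↔ v ∈ S} := by
    ext ω
    simp only [Set.mem_preimage, Set.mem_singleton_iff, Finset.ext_iff, mem_confinedVerts,
      Set.mem_iInter, Set.mem_ofPred_eq, Set.mem_compl_iff]
  rw [this]
  exact .iInter fun v => (measurableSet_exits Λ v).compl.iff (MeasurableSet.const _)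

lemma dependsOn_preimage_confinedVerts (Λ S : Finset V) :
    DependsOn (· ∈ confinedVerts (G := G) Λ ⁻¹' {S}) (edgesIn G S)ᶜ := by
  refine dependsOn_mem_of_forall_imp fun ω ω' h hω => ?_
  obtain rfl : confinedVerts Λ ω = S := hω
  have adj_iff {u w : V} (huw : ¬ (u ∈ confinedVerts Λ ω ∧ w ∈ confinedVerts Λ ω)) :
      (openSubgraph ω).Adj u w ↔ (openSubgraph ω').Adj u w := by
    refine openSubgraph_adj_congr fun e he => h e fun he' => huw ?_
    exact ⟨he' u (he ▸ Sym2.mem_mk_left u w), he' w (he ▸ Sym2.mem_mk_right u w)⟩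
  refine Finset.ext fun v => not_iff_not.mp ⟨fun hv hv' => ?_, fun hv => ?_⟩
  · rw [mem_confinedVerts, not_not] at hv
    obtain ⟨z, hz, hvz⟩ := hv
    refine hz (confinedVerts_subset (mem_of_reachable (A := confinedVerts Λ ω) ?_ hv' hvz))
    refine fun u hu w huw => by_contra fun hw => hw ?_
    exact mem_confinedVerts_of_reachable ((adj_iff fun h' => hw h'.2).mpr huw).reachable hu
  · rw [mem_confinedVerts, not_not]
    obtain ⟨z, hz, hvz⟩ := not_not.mp (mt mem_confinedVerts.mpr hv)
    refine ⟨z, hz, (reachable_iff_of_adj_iff fun u w hu => adj_iff fun h' => hv ?_).mp hvz⟩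
    exact mem_confinedVerts_of_reachable hu.symm h'.1

lemma mem_pivotal_exits [G.LocallyFinite] (hx : x ∈ confinedVerts Λ ω) {d : G.Dart}
    (hd : d ∈ outDarts G (confinedVerts Λ ω))
    (h : (within (openSubgraph ω) (confinedVerts Λ ω)).Reachable x d.fst) :
    ω ∈ pivotal (exits Λ x) (edgeOfDart d) := by
  refine mem_pivotal_of_forall_ge (isUpperSet_exits Λ x) (mem_confinedVerts.mp hx)
    fun ω' hω' hopen => ?_
  have snd_exits : ω ∈ exits Λ d.snd :=
    not_not.mp (mt mem_confinedVerts.mpr (mem_outDarts.mp hd).2)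
  have fst_adj_snd : (openSubgraph ω').Adj d.fst d.snd := openSubgraph_adj.mpr ⟨d.adj, hopen⟩
  exact mem_exits_of_reachable
    ((h.mono ((within_le _ _).trans (openSubgraph_mono hω'))).trans fst_adj_snd.reachable)
    (isUpperSet_exits Λ d.snd hω' snd_exits)

lemma real_preimage_confinedVerts_mul_le [Countable V] [G.LocallyFinite] (r : G.edgeSet → I)
    (Λ : Finset V) (hx : x ∈ S) {d : G.Dart} (hd : d ∈ outDarts G S) :
    (bernoulliPi r).real (confinedVerts Λ ⁻¹' {S}) *
        (bernoulliPi r).real {ω | (within (openSubgraph ω) S).Reachable x d.fst} ≤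
      (bernoulliPi r).real (confinedVerts Λ ⁻¹' {S} ∩ pivotal (exits Λ x) (edgeOfDart d)) := by
  rw [← bernoulliPi_real_inter_of_disjoint r (disjoint_compl_left (a := edgesIn G S))
    (dependsOn_preimage_confinedVerts Λ S)
    (dependsOn_within_openSubgraph (fun H => H.Reachable x d.fst) S)
    (measurableSet_preimage_confinedVerts Λ S)
    (measurableSet_reachable (measurableSet_within_openSubgraph_adj _) x d.fst)]
  refine measureReal_mono ?_ (measure_ne_top _ _)
  rintro ω ⟨rfl, hω⟩
  exact ⟨rfl, mem_pivotal_exits hx hd hω⟩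

lemma real_preimage_confinedVerts_le_sum [Countable V] [G.LocallyFinite] {r : G.edgeSet → I}
    {w : G.edgeSet → ℝ} (hw : 0 ≤ w) (hx : x ∈ S) (hflux : 1 ≤ boundaryFlux r w x S)
    {F : Finset G.edgeSet} (hF : edgesAt G S ⊆ F) :
    (bernoulliPi r).real (confinedVerts Λ ⁻¹' {S}) ≤ ∑ e ∈ F, w e *
      (bernoulliPi r).real (confinedVerts Λ ⁻¹' {S} ∩ pivotal (exits Λ x) e) := by
  classical
  set m : G.edgeSet → ℝ := fun e =>
    w e * (bernoulliPi r).real (confinedVerts Λ ⁻¹' {S} ∩ pivotal (exits Λ x) e)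
  calc (bernoulliPi r).real (confinedVerts Λ ⁻¹' {S})
      ≤ (bernoulliPi r).real (confinedVerts Λ ⁻¹' {S}) * boundaryFlux r w x S :=
        le_mul_of_one_le_right measureReal_nonneg hflux
    _ ≤ ∑ d ∈ outDarts G S, m (edgeOfDart d) := by
        rw [boundaryFlux, Finset.mul_sum]
        refine Finset.sum_le_sum fun d hd => ?_
        rw [mul_left_comm]
        exact mul_le_mul_of_nonneg_left (real_preimage_confinedVerts_mul_le r Λ hx hd) (hw _)
    _ = ∑ e ∈ (outDarts G S).image edgeOfDart, m e :=
        (Finset.sum_image edgeOfDart_injOn_outDarts).symm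
    _ ≤ ∑ e ∈ F, m e := by
        refine Finset.sum_le_sum_of_subset_of_nonneg ?_ fun e _ _ =>
          mul_nonneg (hw e) measureReal_nonneg
        refine Finset.image_subset_iff.mpr fun d hd => ?_
        exact hF (edgeOfDart_mem_edgesAt (mem_outDarts.mp hd).1)

lemma sum_real_preimage_singleton_inter_le {Ω β : Type*} [MeasurableSpace Ω] (μ : Measure Ω)
    [IsFiniteMeasure μ] {f : Ω → β} (s : Finset β) (hf : ∀ b ∈ s, MeasurableSet (f ⁻¹' {b}))
    (A : Set Ω) : ∑ b ∈ s, μ.real (f ⁻¹' {b} ∩ A) ≤ μ.real A := by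
  calc ∑ b ∈ s, μ.real (f ⁻¹' {b} ∩ A) = (μ.restrict A).real (f ⁻¹' s) := by
        rw [← sum_measureReal_preimage_singleton s hf]
        exact Finset.sum_congr rfl fun b hb => (measureReal_restrict_apply (hf b hb)).symm
    _ ≤ (μ.restrict A).real Set.univ := measureReal_mono (Set.subset_univ _)
    _ = μ.real A := measureReal_restrict_apply_univ A

lemma one_sub_real_exits_le_sum_pivotal [Countable V] [G.LocallyFinite] {r : G.edgeSet → I}
    {w : G.edgeSet → ℝ} (hw : 0 ≤ w) (hflux : ∀ S : Finset V, x ∈ S → 1 ≤ boundaryFlux r w x S)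
    {F : Finset G.edgeSet} (hF : edgesAt G Λ ⊆ F) :
    1 - (bernoulliPi r).real (exits Λ x) ≤
      ∑ e ∈ F, w e * (bernoulliPi r).real (pivotal (exits Λ x) e) := by
  classical
  set P : Finset (Finset V) := Λ.powerset.filter (x ∈ ·)
  have compl_exits : (exits (G := G) Λ x)ᶜ = confinedVerts Λ ⁻¹' (P : Set (Finset V)) := by
    ext ω
    simp [P, mem_confinedVerts, confinedVerts_subset]
  calc 1 - (bernoulliPi r).real (exits Λ x)
      = ∑ S ∈ P, (bernoulliPi r).real (confinedVerts Λ ⁻¹' {S}) := by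
        rw [← probReal_compl_eq_one_sub (measurableSet_exits Λ x), compl_exits,
          sum_measureReal_preimage_singleton P fun S _ => measurableSet_preimage_confinedVerts Λ S]
    _ ≤ ∑ S ∈ P, ∑ e ∈ F, w e *
          (bernoulliPi r).real (confinedVerts Λ ⁻¹' {S} ∩ pivotal (exits Λ x) e) := by
        refine Finset.sum_le_sum fun S hS => ?_
        obtain ⟨hSΛ, hx⟩ := Finset.mem_filter.mp hS
        refine real_preimage_confinedVerts_le_sum hw hx (hflux S hx) (subset_trans ?_ hF)
        exact fun e ⟨v, hv, hvS⟩ => ⟨v, hv, Finset.mem_powerset.mp hSΛ hvS⟩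
    _ ≤ ∑ e ∈ F, w e * (bernoulliPi r).real (pivotal (exits Λ x) e) := by
        rw [Finset.sum_comm]
        refine Finset.sum_le_sum fun e _ => ?_
        rw [← Finset.mul_sum]
        exact mul_le_mul_of_nonneg_left (sum_real_preimage_singleton_inter_le _ P
          (fun S _ => measurableSet_preimage_confinedVerts Λ S) _) (hw e)

lemma one_sub_exp_sub_le_of_one_sub_le_deriv {f f' : ℝ → ℝ} {a b : ℝ} (hab : a ≤ b)
    (hf : ∀ t ∈ Set.Icc a b, HasDerivWithinAt f (f' t) (Set.Icc a b) t)
    (hf' : ∀ t ∈ Set.Icc a b, 1 - f t ≤ f' t) (ha : 0 ≤ f a) :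
    1 - Real.exp (a - b) ≤ f b := by
  have antitone : AntitoneOn (fun t => (1 - f t) * Real.exp t) (Set.Icc a b) := by
    have deriv_eq (t : ℝ) (ht : t ∈ Set.Icc a b) :=
      ((hf t ht).const_sub 1).mul (Real.hasDerivAt_exp t).hasDerivWithinAt
    refine antitoneOn_of_hasDerivWithinAt_nonpos (convex_Icc a b)
      (fun t ht => (deriv_eq t ht).continuousWithinAt)
      (fun t ht => (deriv_eq t (interior_subset ht)).mono interior_subset) fun t ht => ?_
    nlinarith [Real.exp_pos t, hf' t (interior_subset ht)]
  have endpoints : (1 - f b) * Real.exp b ≤ (1 - f a) * Real.exp a :=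
    antitone (Set.left_mem_Icc.mpr hab) (Set.right_mem_Icc.mpr hab) hab
  have one_sub_le : 1 - f b ≤ Real.exp a / Real.exp b := by
    rw [le_div_iff₀ (Real.exp_pos b)]
    nlinarith [Real.exp_pos a]
  rw [Real.exp_sub]
  linarith

lemma one_sub_exp_sub_le_real_exits [Countable V] [G.LocallyFinite] {r : ℝ → G.edgeSet → I}
    {r' : ℝ → G.edgeSet → ℝ} {a b : ℝ} (hab : a ≤ b)
    (hr : ∀ t ∈ Set.Icc a b, ∀ e,
      HasDerivWithinAt (fun u => (r u e : ℝ)) (r' t e) (Set.Icc a b) t)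
    (hr' : ∀ t ∈ Set.Icc a b, 0 ≤ r' t)
    (hflux : ∀ t ∈ Set.Icc a b, ∀ S : Finset V, x ∈ S → 1 ≤ boundaryFlux (r t) (r' t) x S)
    (Λ : Finset V) : 1 - Real.exp (a - b) ≤ (bernoulliPi (r b)).real (exits Λ x) := by
  have finite_edges := finite_edgesAt G Λ.finite_toSet
  have dependsOn : DependsOn (· ∈ exits (G := G) Λ x) (finite_edges.toFinset : Set G.edgeSet) := by
    rw [finite_edges.coe_toFinset]
    exact dependsOn_exits Λ x
  refine one_sub_exp_sub_le_of_one_sub_le_deriv hab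
    (fun t ht => hasDerivWithinAt_bernoulliPi_real_of_isUpperSet (hr t ht) dependsOn
      (isUpperSet_exits Λ x))
    (fun t ht => one_sub_real_exits_le_sum_pivotal (hr' t ht) (hflux t ht) ?_) measureReal_nonneg
  exact finite_edges.coe_toFinset.ge

lemma one_sub_exp_sub_le_real_percolatesFrom [Countable V] [G.LocallyFinite]
    {r : ℝ → G.edgeSet → I} {r' : ℝ → G.edgeSet → ℝ} {a b : ℝ} (hab : a ≤ b)
    (hr : ∀ t ∈ Set.Icc a b, ∀ e,
      HasDerivWithinAt (fun u => (r u e : ℝ)) (r' t e) (Set.Icc a b) t)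
    (hr' : ∀ t ∈ Set.Icc a b, 0 ≤ r' t)
    (hflux : ∀ t ∈ Set.Icc a b, ∀ S : Finset V, x ∈ S → 1 ≤ boundaryFlux (r t) (r' t) x S) :
    1 - Real.exp (a - b) ≤ (bernoulliPi (r b)).real (percolatesFrom G x) := by
  classical
  refine (ENNReal.ofReal_le_iff_le_toReal (measure_ne_top _ _)).mp ?_
  rw [percolatesFrom_eq_iInter_exits, (exits_antitone x).directed_ge.measure_iInter
    (fun Λ => (measurableSet_exits Λ x).nullMeasurableSet) ⟨∅, measure_ne_top _ _⟩]
  exact le_iInf fun Λ => (ENNReal.ofReal_le_iff_le_toReal (measure_ne_top _ _)).mpr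
    (one_sub_exp_sub_le_real_exits hab hr hr' hflux Λ)

end Supercritical

section Defect

open Filter Topology

variable {V : Type*} {G : SimpleGraph V} {D : Set G.edgeSet} {o : V}

open scoped Classical in
/-- The parameters of inhomogeneous percolation with defect set `D`: the edges in `D` are open with
probability `q`, all others with probability `p`. -/
noncomputable def defectParam (D : Set G.edgeSet) (p q : I) : G.edgeSet → I :=
  D.piecewise (fun _ => q) fun _ => p

lemma defectParam_of_mem {e : G.edgeSet} (he : e ∈ D) (p q : I) : defectParam D p q e = q := by
  classical
  exact Set.piecewise_eq_of_mem _ _ _ he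

lemma defectParam_of_notMem {e : G.edgeSet} (he : e ∉ D) (p q : I) : defectParam D p q e = p := by
  classical
  exact Set.piecewise_eq_of_notMem _ _ _ he

lemma continuous_defectParam (D : Set G.edgeSet) (q : I) :
    Continuous fun p => defectParam D p q := by
  refine continuous_pi fun e => ?_
  by_cases he : e ∈ D
  · simpa only [defectParam_of_mem he] using continuous_const
  · simpa only [defectParam_of_notMem he] using continuous_id'

lemma hasDerivWithinAt_defectParam (D : Set G.edgeSet) (p : I) {t : ℝ} (ht : t ∈ I)
    (e : G.edgeSet) : HasDerivWithinAt
      (fun u => (defectParam D p (Set.projIcc 0 1 zero_le_one u) e : ℝ)) (D.indicator 1 e) I t := by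
  by_cases he : e ∈ D
  · simp only [defectParam_of_mem he, Set.indicator_of_mem he, Pi.one_apply]
    exact (hasDerivWithinAt_id t I).congr_of_mem
      (fun u hu => congrArg Subtype.val (Set.projIcc_of_mem zero_le_one hu)) ht
  · simpa only [defectParam_of_notMem he, Set.indicator_of_notMem he] using
      hasDerivWithinAt_const t I (p : ℝ)

lemma bernoulliPi_defectParam_zero_le [Countable V] (D : Set G.edgeSet) (p q : I) (o : V) :
    bernoulliPi (defectParam D 0 q) (percolatesFrom G o) ≤
      bernoulliPi (defectParam D p q) (percolatesFrom G o) := by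
  classical
  have thin_eq : defectParam D 0 q = D.piecewise (defectParam D p q) fun _ => 0 := by
    ext e
    by_cases he : e ∈ D <;> simp [he, defectParam_of_mem, defectParam_of_notMem]
  rw [thin_eq]
  exact bernoulliPi_piecewise_zero_le _ D (measurableSet_percolatesFrom G o)
    (isUpperSet_percolatesFrom G o)

lemma exists_boundaryFlux_lt_one [Countable V] [G.LocallyFinite] {q₀ q₁ : I} (h01 : q₀ < q₁)
    (h : bernoulliPi (defectParam D 0 q₁) (percolatesFrom G o) = 0) :
    ∃ q ∈ Set.Icc q₀ q₁, ∃ S : Finset V, o ∈ S ∧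
      boundaryFlux (defectParam D 0 q) (fun e => defectParam D 0 q e) o S < 1 := by
  by_contra! one_le_flux
  have Icc_subset : Set.Icc (q₀ : ℝ) q₁ ⊆ I := Set.Icc_subset_Icc q₀.2.1 q₁.2.2
  have param_le_indicator (q : I) :
      (fun e => (defectParam D 0 q e : ℝ)) ≤ D.indicator (1 : G.edgeSet → ℝ) := fun e => by
    by_cases he : e ∈ D
    · simpa only [defectParam_of_mem he, Set.indicator_of_mem he, Pi.one_apply] using q.2.2
    · simp only [defectParam_of_notMem he, Set.indicator_of_notMem he, Set.Icc.coe_zero, le_refl]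
  have lower_bound := one_sub_exp_sub_le_real_percolatesFrom (x := o)
    (r := fun t => defectParam D 0 (Set.projIcc 0 1 zero_le_one t)) (r' := fun _ => D.indicator 1)
    h01.le (fun t ht e => (hasDerivWithinAt_defectParam D 0 (Icc_subset ht) e).mono Icc_subset)
    (fun _ _ => Set.indicator_nonneg fun _ _ => zero_le_one) fun t ht S ho => by
      rw [Set.projIcc_of_mem zero_le_one (Icc_subset ht)]
      exact (one_le_flux ⟨t, Icc_subset ht⟩ ht S ho).trans
        (boundaryFlux_mono _ (param_le_indicator _) o S)
  rw [Set.projIcc_val, measureReal_def, h, ENNReal.toReal_zero, sub_nonpos, Real.one_le_exp_iff,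
    sub_nonneg] at lower_bound
  exact lower_bound.not_gt h01

/-- The defect edges all lie in the orbit of `o`: every endpoint of an edge in `D` is the image of
`o` under an automorphism of `G` which preserves `D`. -/
def IsHomogeneousDefect (D : Set G.edgeSet) (o : V) : Prop :=
  ∀ e ∈ D, ∀ x ∈ (e : Sym2 V), ∃ φ : G ≃g G, φ o = x ∧ ∀ e, φ.mapEdgeSet e ∈ D ↔ e ∈ D

lemma real_percolatesFrom_le_mul_of_defectParam [Countable V] [G.LocallyFinite]
    (hD : IsHomogeneousDefect D o) {p q : I} {S : Finset V} (ho : o ∈ S) {c θ : ℝ}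
    (hS : boundaryFlux (defectParam D p q) (fun e => defectParam D p q e) o S ≤ c)
    (hp : ∀ x, G.degree x * (p : ℝ) ≤ c)
    (hθ : ∀ z, (bernoulliPi (defectParam D p q)).real (percolatesFrom G z) ≤ θ) (x : V) :
    (bernoulliPi (defectParam D p q)).real (percolatesFrom G x) ≤ c * θ := by
  have hθ0 : 0 ≤ θ := measureReal_nonneg.trans (hθ o)
  by_cases hx : ∃ e ∈ D, x ∈ (e : Sym2 V)
  · obtain ⟨e, he, hxe⟩ := hx
    obtain ⟨φ, rfl, hφ⟩ := hD e he x hxe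
    rw [bernoulliPi_real_percolatesFrom_apply _ φ fun e => by
      classical exact if_congr (hφ e) rfl rfl]
    exact (real_percolatesFrom_le_boundaryFlux_mul hθ ho).trans
      (mul_le_mul_of_nonneg_right hS hθ0)
  · push Not at hx
    refine (real_percolatesFrom_le_boundaryFlux_mul hθ (Finset.mem_singleton_self x)).trans
      (mul_le_mul_of_nonneg_right ((boundaryFlux_singleton_le p.2.1 fun e he => ?_).trans (hp x))
        hθ0)
    exact congrArg Subtype.val (defectParam_of_notMem (fun h => hx e h he) p q) |>.le

lemma eventually_bernoulliPi_percolatesFrom_eq_zero [Countable V] [G.LocallyFinite] {Δ : ℕ}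
    (hΔ : ∀ v, G.degree v ≤ Δ) (hD : IsHomogeneousDefect D o) {q : I} {S : Finset V} (ho : o ∈ S)
    (hS : boundaryFlux (defectParam D 0 q) (fun e => defectParam D 0 q e) o S < 1) :
    ∀ᶠ p in 𝓝 0, bernoulliPi (defectParam D p q) (percolatesFrom G o) = 0 := by
  obtain ⟨c, hc, hc1⟩ := exists_between (max_lt hS one_pos)
  have flux_lt : ∀ᶠ p in 𝓝 0,
      boundaryFlux (defectParam D p q) (fun e => defectParam D p q e) o S < c :=
    ((continuous_boundaryFlux o S).comp (continuous_defectParam D q)).continuousAt.eventually_lt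
      continuousAt_const ((le_max_left _ _).trans_lt hc)
  have degree_mul_lt : ∀ᶠ p : I in 𝓝 0, Δ * (p : ℝ) < c := by
    refine ContinuousAt.eventually_lt (by fun_prop) continuousAt_const ?_
    simpa only [Set.Icc.coe_zero, mul_zero] using (le_max_right _ _).trans_lt hc
  filter_upwards [flux_lt, degree_mul_lt] with p hflux hdegree
  refine bernoulliPi_percolatesFrom_eq_zero hc1 (fun θ hθ x =>
    real_percolatesFrom_le_mul_of_defectParam hD ho hflux.le (fun x => ?_) hθ x) o
  exact (mul_le_mul_of_nonneg_right (Nat.cast_le.mpr (hΔ x)) p.2.1).trans hdegree.le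

/-- The critical value `q_c(p)` of the parameter on the defect set `D`, for percolation from `o`.
For an empty set of parameters the supremum is `0`, as the convention in the paper demands. -/
noncomputable def defectCriticalParam (D : Set G.edgeSet) (o : V) (p : I) : ℝ :=
  sSup {x : ℝ | ∃ q : I, (q : ℝ) = x ∧ bernoulliPi (defectParam D p q) (percolatesFrom G o) = 0}

lemma defectCriticalParam_nonneg (D : Set G.edgeSet) (o : V) (p : I) :
    0 ≤ defectCriticalParam D o p := by
  refine Real.sSup_nonneg ?_
  rintro _ ⟨q, rfl, -⟩
  exact q.2.1

lemma le_defectCriticalParam {p q : I}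
    (h : bernoulliPi (defectParam D p q) (percolatesFrom G o) = 0) :
    (q : ℝ) ≤ defectCriticalParam D o p := by
  refine le_csSup ⟨1, ?_⟩ ⟨q, rfl, h⟩
  rintro _ ⟨q, rfl, -⟩
  exact q.2.2

lemma exists_lt_of_lt_defectCriticalParam {a : ℝ} (ha0 : 0 ≤ a) {p : I}
    (ha : a < defectCriticalParam D o p) :
    ∃ q : I, a < q ∧ bernoulliPi (defectParam D p q) (percolatesFrom G o) = 0 := by
  by_contra! h
  refine (Real.sSup_le ?_ ha0).not_gt ha
  rintro _ ⟨q, rfl, hq⟩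
  exact not_lt.mp fun haq => h q haq hq

lemma defectCriticalParam_le_zero [Countable V] (D : Set G.edgeSet) (o : V) (p : I) :
    defectCriticalParam D o p ≤ defectCriticalParam D o 0 := by
  refine Real.sSup_le ?_ (defectCriticalParam_nonneg D o 0)
  rintro _ ⟨q, rfl, hq⟩
  exact le_defectCriticalParam
    (le_antisymm ((bernoulliPi_defectParam_zero_le D p q o).trans hq.le) zero_le)

lemma eventually_lt_defectCriticalParam [Countable V] [G.LocallyFinite] {Δ : ℕ}
    (hΔ : ∀ v, G.degree v ≤ Δ) (hD : IsHomogeneousDefect D o) {a : ℝ}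
    (ha : a < defectCriticalParam D o 0) : ∀ᶠ p in 𝓝 0, a < defectCriticalParam D o p := by
  rcases lt_or_ge a 0 with ha0 | ha0
  · exact .of_forall fun p => ha0.trans_le (defectCriticalParam_nonneg D o p)
  obtain ⟨q₁, haq, hq₁⟩ := exists_lt_of_lt_defectCriticalParam ha0 ha
  obtain ⟨b, hab, hbq⟩ := exists_between haq
  obtain ⟨q, ⟨hbq', -⟩, S, ho, hS⟩ :=
    exists_boundaryFlux_lt_one (q₀ := ⟨b, ha0.trans hab.le, hbq.le.trans q₁.2.2⟩) hbq hq₁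
  filter_upwards [eventually_bernoulliPi_percolatesFrom_eq_zero hΔ hD ho hS] with p hp
  exact hab.trans_le ((Subtype.coe_le_coe.mpr hbq').trans (le_defectCriticalParam hp))

end Defect

section Lattice

variable {d : ℕ}

noncomputable instance (d : ℕ) : (lattice d).LocallyFinite := fun x =>
  Set.Finite.fintype <| (Set.finite_Icc (x - 1) (x + 1)).subset fun y (hxy : _ = _) => by
    have abs_le_one (i : Fin d) : |x i - y i| ≤ 1 :=
      hxy ▸ Finset.single_le_sum (f := fun i => |x i - y i|) (fun i _ => abs_nonneg _)
        (Finset.mem_univ i)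
    simp only [Set.mem_Icc, Pi.le_def, Pi.sub_apply, Pi.add_apply, Pi.one_apply]
    exact ⟨fun i => by grind, fun i => by grind⟩

/-- Translation by `a`, as an automorphism of the hypercubic lattice. -/
def latticeTranslation (a : Fin d → ℤ) : lattice d ≃g lattice d where
  toEquiv := Equiv.addLeft a
  map_rel_iff' := by simp [lattice]

lemma degree_lattice (x : Fin d → ℤ) : (lattice d).degree x = (lattice d).degree 0 := by
  rw [← (latticeTranslation x).degree_eq 0, show latticeTranslation x 0 = x from add_zero x]

lemma add_mem_sublattice_iff {s : ℕ} {a : Fin d → ℤ} (ha : a ∈ sublattice d s) {y : Fin d → ℤ} :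
    a + y ∈ sublattice d s ↔ y ∈ sublattice d s :=
  forall₂_congr fun i hi => by rw [Pi.add_apply, ha i hi, zero_add]

lemma isHomogeneousDefect_sublattice (d s : ℕ) :
    IsHomogeneousDefect (edgesIn (lattice d) (sublattice d s)) 0 := by
  intro e he x hx
  refine ⟨latticeTranslation x, add_zero x, fun e => ?_⟩
  have hx := he x hx
  simp [edgesIn, latticeTranslation, Sym2.mem_map, add_mem_sublattice_iff hx]

lemma criticalParam_eq_defectCriticalParam (d s : ℕ) (p : I) :
    criticalParam d s p = defectCriticalParam (edgesIn (lattice d) (sublattice d s)) 0 p :=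
  rfl

end Lattice

end DefectPercolation

open DefectPercolation in
theorem mainTheorem4_general {V : Type*} [Countable V] {G : SimpleGraph V} [G.LocallyFinite] {Δ : ℕ}
    (hΔ : ∀ v, G.degree v ≤ Δ) {D : Set G.edgeSet} {o : V} (hD : IsHomogeneousDefect D o) :
    ContinuousAt (defectCriticalParam D o) 0 :=
  tendsto_order.mpr ⟨fun _ ha => eventually_lt_defectCriticalParam hΔ hD ha,
    fun _ ha => .of_forall fun p => (defectCriticalParam_le_zero D o p).trans_lt ha⟩

theorem mainTheorem4 (d s : ℕ) (hs : 1 ≤ s) (hsd : s ≤ d) :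
    ContinuousAt (fun p : unitInterval => DefectPercolation.criticalParam d s p) 0 := by
  simp only [DefectPercolation.criticalParam_eq_defectCriticalParam]
  exact mainTheorem4_general (fun v => (DefectPercolation.degree_lattice v).le)
    (DefectPercolation.isHomogeneousDefect_sublattice d s)
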